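/- Let $N\ge 1$ be an integer and $\nu>0$. Let $W_N^B=\{x\in\mathbb R^N: x_1>x_2>\dots>x_N>0\}$, let $\|\cdot\|$ be the Euclidean norm, and consider on $W_N^B$ the ODE $$\frac{dx_i(t)}{dt}=\sum_{j\ne i}\Bigl(\frac1{x_i(t)-x_j(t)}+\frac1{x_i(t)+x_j(t)}\Bigr)+\frac{\nu}{x_i(t)}\qquad(i=1,\dots,N).\tag{1}$$ Let $L_N^{(\nu-1)}(x)=\sum_{k=0}^N(-1)^k\binom{N+\nu-1}{N-k}\frac{x^k}{k!}$ be the Laguerre polynomial (the orthogonal polynomial of degree $N$ for the density $e^{-x}x^{\nu-1}$ on $(0,\infty)$). It has exactly $N$ real zeros $z_1>\dots>z_N>0$; let $y\in W_N^B$ be the vector with $y_i^2=2z_i$ for $i=1,\dots,N$. Then for each starting point $x_0\in W_N^B$, the ODE (1) has a unique solution $x:[0,\infty)\to W_N^B$ with $x(0)=x_0$, and it has the form $$x(t)=\sqrt{2N(N+\nu-1)\,t+\|x_0\|^2}\;\cdot\phi(t)\qquad(t\ge 0)$$ with $$\|\phi(t)\|=1\quad(t\ge 0)\qquad\text{and}\qquad\lim_{t\to\infty}\phi(t)=\frac{1}{\sqrt{2N(N+\nu-1)}}\;y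 .$$ -/

import Mathlib

open Filter Topology

/-- The open Weyl chamber of type `B_N` (the interior of `x₁ ≥ x₂ ≥ ⋯ ≥ x_N ≥ 0`):
all `x ∈ ℝ^N` with `x₁ > x₂ > ⋯ > x_N > 0`. -/
def weylChamberB (N : ℕ) : Set (EuclideanSpace ℝ (Fin N)) :=
  {x | (∀ i j : Fin N, i < j → x j < x i) ∧ ∀ i : Fin N, 0 < x i}

/-- The vector field
`H_ν(x)_i = ∑_{j ≠ i} (1 / (x_i - x_j) + 1 / (x_i + x_j)) + ν / x_i`
(used on the open Weyl chamber only, where no denominator vanishes). -/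
noncomputable def fieldB (N : ℕ) (ν : ℝ) (x : EuclideanSpace ℝ (Fin N)) :
    EuclideanSpace ℝ (Fin N) :=
  WithLp.toLp 2 fun i : Fin N =>
    (∑ j ∈ Finset.univ.erase i, (1 / (x i - x j) + 1 / (x i + x j))) + ν / x i

/-- `x : [0, ∞) → W_N^B` solves `dx/dt = H_ν(x)` with `x(0) = x₀`. Only the values of `x` on
`[0, ∞)` matter; the derivative at `0` is one-sided. -/
structure IsSolutionB (N : ℕ) (ν : ℝ) (x₀ : EuclideanSpace ℝ (Fin N))
    (x : ℝ → EuclideanSpace ℝ (Fin N)) : Prop where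
  init : x 0 = x₀
  mem : ∀ t : ℝ, 0 ≤ t → x t ∈ weylChamberB N
  ode : ∀ t : ℝ, 0 ≤ t → HasDerivWithinAt x (fieldB N ν (x t)) (Set.Ici 0) t

/-- The Laguerre polynomial
`L_n^{(α)}(X) = ∑_{k=0}^n (-1)^k * binom (n + α) (n - k) * X^k / k!`, where the generalized
binomial coefficient is `binom (n + α) (n - k) = (α + k + 1) ⋯ (α + n) / (n - k)!`. -/
noncomputable def laguerrePoly (n : ℕ) (α : ℝ) : Polynomial ℝ :=
  ∑ k ∈ Finset.range (n + 1),
    Polynomial.C ((-1) ^ k * ((∏ j ∈ Finset.Icc (k + 1) n, (α + (j : ℝ))) /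
      ((n - k).factorial : ℝ)) / (k.factorial : ℝ)) * Polynomial.X ^ k

/-! The field is the gradient of Φ(x) = ∑ k_r log⟨v_r, x⟩, where v_r runs over the positive roots of
B_N and k_r is ν on short roots, 1 on long ones. Φ is concave on the chamber, so solutions do not
move apart (`antitoneOn_norm_sub_of_logGradient`); this gives uniqueness. Euler's identity ⟨∇Φ(x),
x⟩ = K := ∑ k_r = N(N+ν-1) makes ‖x(t)‖² exactly linear in t.

If ∇Φ(y) = y, then √(2Kt + c) y/√K is a self-similar solution. Every other solution stays within
bounded distance of it, so dividing by the growing radius forces convergence of directions. Such a y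
comes from maximising a degree-zero version of Φ (`exists_logGradient_eq_self`).

Global existence follows by truncating the singularities: Φ increases along its flow, which keeps
the trajectory away from the walls. Finally, by Stieltjes' argument, ∏(X - y_i²) solves Laguerre's
equation, so the y_i² are exactly the Laguerre zeros. -/

/-! ### Monotonicity and homogeneity of logarithmic gradient fields -/

section LogGradient

open Set

variable {E ι : Type*} [NormedAddCommGroup E] [InnerProductSpace ℝ E] [Fintype ι]

/-- The gradient of `x ↦ ∑ r, k r * log ⟪v r, x⟫`. -/
noncomputable def logGradient (v : ι → E) (k : ι → ℝ) (x : E) : E :=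
  ∑ r, (k r / inner ℝ (v r) x) • v r

/-- The open cone on which all `⟪v r, x⟫` are positive. -/
def openCone (v : ι → E) : Set E := {x | ∀ r, 0 < inner ℝ (v r) x}

variable {v : ι → E} {k : ι → ℝ}

theorem inner_logGradient_left (x y : E) :
    inner ℝ (logGradient v k x) y = ∑ r, k r / inner ℝ (v r) x * inner ℝ (v r) y := by
  simp [logGradient, sum_inner, real_inner_smul_left]

theorem inner_logGradient_self {x : E} (hx : x ∈ openCone v) :
    inner ℝ (logGradient v k x) x = ∑ r, k r := by
  rw [inner_logGradient_left]
  exact Finset.sum_congr rfl fun r _ ↦ div_mul_cancel₀ _ (hx r).ne'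

theorem logGradient_smul (c : ℝ) (x : E) :
    logGradient v k (c • x) = c⁻¹ • logGradient v k x := by
  simp only [logGradient, Finset.smul_sum, real_inner_smul_right, smul_smul]
  refine Finset.sum_congr rfl fun r _ ↦ ?_
  rw [div_mul_eq_div_div_swap, div_eq_inv_mul _ c]

/-- Concavity of the potential: each a ↦ k_r / a is decreasing on a > 0. -/
theorem inner_logGradient_sub_nonpos (hk : ∀ r, 0 ≤ k r) {x y : E} (hx : x ∈ openCone v)
    (hy : y ∈ openCone v) :
    inner ℝ (x - y) (logGradient v k x - logGradient v k y) ≤ 0 := by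
  rw [real_inner_comm, inner_sub_left, inner_logGradient_left, inner_logGradient_left,
    ← Finset.sum_sub_distrib]
  refine Finset.sum_nonpos fun r _ ↦ ?_
  have ha := hx r
  have hb := hy r
  rw [inner_sub_right]
  have : k r / inner ℝ (v r) x * (inner ℝ (v r) x - inner ℝ (v r) y)
      - k r / inner ℝ (v r) y * (inner ℝ (v r) x - inner ℝ (v r) y)
      = -(k r * (inner ℝ (v r) x - inner ℝ (v r) y) ^ 2
        / (inner ℝ (v r) x * inner ℝ (v r) y)) := by
    field_simp
    ring
  rw [this, neg_nonpos]
  have := hk r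
  positivity

/-- The distance between two solutions of the gradient flow does not increase. -/
theorem antitoneOn_norm_sub_of_logGradient (hk : ∀ r, 0 ≤ k r) {D : Set ℝ} (hD : Convex ℝ D)
    {x y : ℝ → E} (hxm : ∀ t ∈ D, x t ∈ openCone v) (hym : ∀ t ∈ D, y t ∈ openCone v)
    (hx : ∀ t ∈ D, HasDerivWithinAt x (logGradient v k (x t)) D t)
    (hy : ∀ t ∈ D, HasDerivWithinAt y (logGradient v k (y t)) D t) :
    AntitoneOn (fun t ↦ ‖x t - y t‖) D := by
  have hd := fun t ht ↦ ((hx t ht).sub (hy t ht)).norm_sq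
  have h : AntitoneOn (fun t ↦ ‖x t - y t‖ ^ 2) D := by
    refine antitoneOn_of_hasDerivWithinAt_nonpos hD (fun t ht ↦ (hd t ht).continuousWithinAt)
      (fun t ht ↦ (hd t (interior_subset ht)).mono interior_subset) fun t ht ↦ ?_
    have := inner_logGradient_sub_nonpos hk (hxm t (interior_subset ht))
      (hym t (interior_subset ht))
    exact mul_nonpos_of_nonneg_of_nonpos zero_le_two this
  exact fun s hs t ht hst ↦ (sq_le_sq₀ (norm_nonneg _) (norm_nonneg _)).1 (h hs ht hst)

theorem eqOn_of_logGradient (hk : ∀ r, 0 ≤ k r) {D : Set ℝ} (hD : Convex ℝ D)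
    (hD0 : IsLeast D 0)
    {x y : ℝ → E} (hxm : ∀ t ∈ D, x t ∈ openCone v) (hym : ∀ t ∈ D, y t ∈ openCone v)
    (hx : ∀ t ∈ D, HasDerivWithinAt x (logGradient v k (x t)) D t)
    (hy : ∀ t ∈ D, HasDerivWithinAt y (logGradient v k (y t)) D t) (h0 : x 0 = y 0) :
    EqOn x y D := by
  intro t ht
  have := antitoneOn_norm_sub_of_logGradient hk hD hxm hym hx hy hD0.1 ht (hD0.2 ht)
  simp only [h0, sub_self, norm_zero] at this
  exact sub_eq_zero.1 (norm_le_zero_iff.1 this)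

theorem norm_sq_eq_of_logGradient {x : ℝ → E} (hxm : ∀ t ∈ Ici (0 : ℝ), x t ∈ openCone v)
    (hx : ∀ t ∈ Ici (0 : ℝ), HasDerivWithinAt x (logGradient v k (x t)) (Ici 0) t) {t : ℝ}
    (ht : 0 ≤ t) : ‖x t‖ ^ 2 = 2 * (∑ r, k r) * t + ‖x 0‖ ^ 2 := by
  have hd : ∀ s ∈ Ici (0 : ℝ),
      HasDerivWithinAt (fun s ↦ ‖x s‖ ^ 2 - 2 * (∑ r, k r) * s) 0 (Ici 0) s := by
    intro s hs
    refine ((hx s hs).norm_sq.sub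
      ((hasDerivWithinAt_id s (Ici 0)).const_mul (2 * ∑ r, k r))).congr_deriv ?_
    rw [real_inner_comm, inner_logGradient_self (hxm s hs)]
    ring
  have := (convex_Ici (0 : ℝ)).is_const_of_fderivWithin_eq_zero (𝕜 := ℝ)
    (fun s hs ↦ (hd s hs).differentiableWithinAt)
    (fun s hs ↦ by
      have h1 := (hd s hs).hasFDerivWithinAt.fderivWithin (uniqueDiffOn_Ici 0 s hs)
      rw [h1]; ext; simp) (mem_Ici.2 ht) (mem_Ici.2 le_rfl)
  simp only [mul_zero, sub_zero] at this
  linarith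

end LogGradient

/-! ### Global existence by truncation -/

section TruncatedFlow

open Set

/-- The antiderivative, vanishing at `δ`, of `a ↦ 1 / max a δ`. -/
noncomputable def truncLog (δ a : ℝ) : ℝ := ∫ s in δ..a, 1 / max s δ

theorem hasDerivAt_truncLog {δ : ℝ} (hδ : 0 < δ) (a : ℝ) :
    HasDerivAt (truncLog δ) (1 / max a δ) a := by
  have hc : Continuous fun s : ℝ ↦ 1 / max s δ :=
    continuous_const.div (by fun_prop) fun s ↦ (lt_max_of_lt_right hδ).ne'
  exact hc.integral_hasStrictDerivAt δ a |>.hasDerivAt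

theorem monotone_truncLog {δ : ℝ} (hδ : 0 < δ) : Monotone (truncLog δ) :=
  monotone_of_hasDerivAt_nonneg (hasDerivAt_truncLog hδ) fun a ↦ by
    have : 0 < max a δ := lt_max_of_lt_right hδ
    show 0 ≤ 1 / max a δ
    positivity

theorem truncLog_nonpos {δ a : ℝ} (hδ : 0 < δ) (ha : a ≤ δ) : truncLog δ a ≤ 0 := by
  simpa [truncLog] using monotone_truncLog hδ ha

theorem truncLog_of_le {δ a : ℝ} (hδ : 0 < δ) (ha : δ ≤ a) :
    truncLog δ a = Real.log a - Real.log δ := by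
  rw [← Real.log_div (hδ.trans_le ha).ne' hδ.ne', ← integral_one_div_of_pos hδ (hδ.trans_le ha)]
  refine intervalIntegral.integral_congr fun s hs ↦ ?_
  rw [uIcc_of_le ha] at hs
  simp only [max_eq_left hs.1]

theorem abs_one_div_max_sub_le {δ : ℝ} (hδ : 0 < δ) (a b : ℝ) :
    |1 / max a δ - 1 / max b δ| ≤ 1 / δ ^ 2 * |a - b| := by
  have ha : δ ≤ max a δ := le_max_right _ _
  have hb : δ ≤ max b δ := le_max_right _ _
  have ha' := hδ.trans_le ha
  have hb' := hδ.trans_le hb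
  rw [div_sub_div _ _ ha'.ne' hb'.ne', abs_div, abs_of_pos (mul_pos ha' hb'), one_mul, mul_one,
    div_le_iff₀ (mul_pos ha' hb')]
  have h1 : |max b δ - max a δ| ≤ |a - b| := by
    rw [abs_sub_comm]
    exact abs_max_sub_max_le_abs a b δ
  have h2 : δ ^ 2 ≤ max a δ * max b δ := by rw [sq]; gcongr
  calc |max b δ - max a δ| ≤ |a - b| := h1
    _ = 1 / δ ^ 2 * |a - b| * δ ^ 2 := by field_simp
    _ ≤ _ := by gcongr

variable {E ι : Type*} [NormedAddCommGroup E] [InnerProductSpace ℝ E] [Fintype ι]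

/-- The field `logGradient` with every `⟪v r, x⟫` replaced by `max ⟪v r, x⟫ δ`. -/
noncomputable def truncGradient (v : ι → E) (k : ι → ℝ) (δ : ℝ) (x : E) : E :=
  ∑ r, (k r * (1 / max (inner ℝ (v r) x) δ)) • v r

variable {v : ι → E} {k : ι → ℝ} {δ : ℝ}

theorem truncGradient_eq_logGradient {x : E} (hx : ∀ r, δ ≤ inner ℝ (v r) x) :
    truncGradient v k δ x = logGradient v k x := by
  simp only [truncGradient, logGradient, max_eq_left (hx _), mul_one_div]

theorem inner_truncGradient_left (x y : E) :
    inner ℝ (truncGradient v k δ x) y =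
      ∑ r, k r * (1 / max (inner ℝ (v r) x) δ) * inner ℝ (v r) y := by
  simp [truncGradient, sum_inner, real_inner_smul_left]

theorem norm_truncGradient_le (hk : ∀ r, 0 ≤ k r) (hδ : 0 < δ) (x : E) :
    ‖truncGradient v k δ x‖ ≤ ∑ r, k r * (1 / δ) * ‖v r‖ := by
  refine (norm_sum_le _ _).trans (Finset.sum_le_sum fun r _ ↦ ?_)
  have h : 0 < max (inner ℝ (v r) x) δ := lt_max_of_lt_right hδ
  have := hk r
  rw [norm_smul, Real.norm_of_nonneg (by positivity)]
  gcongr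
  exact le_max_right _ _

theorem lipschitzWith_truncGradient (hk : ∀ r, 0 ≤ k r) (hδ : 0 < δ) :
    LipschitzWith (Real.toNNReal (∑ r, k r * (1 / δ ^ 2 * ‖v r‖) * ‖v r‖))
      (truncGradient v k δ) := by
  refine LipschitzWith.of_dist_le' fun x y ↦ ?_
  rw [dist_eq_norm, dist_eq_norm, truncGradient, truncGradient, ← Finset.sum_sub_distrib,
    Finset.sum_mul]
  refine (norm_sum_le _ _).trans (Finset.sum_le_sum fun r _ ↦ ?_)
  rw [← sub_smul, norm_smul, ← mul_sub, norm_mul, Real.norm_of_nonneg (hk r), Real.norm_eq_abs]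
  have h1 := abs_one_div_max_sub_le hδ (inner ℝ (v r) x) (inner ℝ (v r) y)
  rw [← inner_sub_right] at h1
  have h2 := abs_real_inner_le_norm (v r) (x - y)
  have := hk r
  calc k r * |1 / max (inner ℝ (v r) x) δ - 1 / max (inner ℝ (v r) y) δ| * ‖v r‖
      ≤ k r * (1 / δ ^ 2 * (‖v r‖ * ‖x - y‖)) * ‖v r‖ := by
        gcongr
        exact h1.trans (by gcongr)
    _ = _ := by ring

/-- The truncated field is bounded by some B and globally Lipschitz, so Picard–Lindelöf applies on
all of [0, T] with a ball of radius B * T. -/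
theorem exists_truncGradient_flow [CompleteSpace E] (hk : ∀ r, 0 ≤ k r) (hδ : 0 < δ) (x₀ : E)
    {T : ℝ} (hT : 0 ≤ T) :
    ∃ x : ℝ → E, x 0 = x₀ ∧
      ∀ t ∈ Icc 0 T, HasDerivWithinAt x (truncGradient v k δ (x t)) (Icc 0 T) t := by
  set B : ℝ := ∑ r, k r * (1 / δ) * ‖v r‖ with hB
  have hB0 : 0 ≤ B := (norm_nonneg _).trans (norm_truncGradient_le hk hδ x₀)
  have hpl : IsPicardLindelof (fun _ : ℝ ↦ truncGradient v k δ)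
      (⟨0, left_mem_Icc.2 hT⟩ : Icc 0 T) x₀ (B * T).toNNReal 0 B.toNNReal
      (Real.toNNReal (∑ r, k r * (1 / δ ^ 2 * ‖v r‖) * ‖v r‖)) := by
    refine .of_time_independent (fun x _ ↦ ?_) (lipschitzWith_truncGradient hk hδ).lipschitzOnWith
      ?_
    · rw [Real.coe_toNNReal _ hB0]
      exact norm_truncGradient_le hk hδ x
    · simp [Real.coe_toNNReal _ hB0, Real.coe_toNNReal _ (mul_nonneg hB0 hT), hT]
  exact hpl.exists_eq_forall_mem_Icc_hasDerivWithinAt₀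

/-- Since a / max a δ ≤ 1 for every real a, Euler's identity survives as an inequality. The bound
does not involve δ, so δ can be chosen after it. -/
theorem norm_sq_le_of_truncGradient (hk : ∀ r, 0 ≤ k r) (hδ : 0 < δ) {T : ℝ} {x : ℝ → E}
    (hx : ∀ t ∈ Icc 0 T, HasDerivWithinAt x (truncGradient v k δ (x t)) (Icc 0 T) t) {t : ℝ}
    (ht : t ∈ Icc 0 T) : ‖x t‖ ^ 2 ≤ ‖x 0‖ ^ 2 + 2 * (∑ r, k r) * t := by
  have hd := fun t ht ↦ ((hx t ht).norm_sq).sub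
      ((hasDerivWithinAt_id t (Icc 0 T)).const_mul (2 * ∑ r, k r))
  have h := antitoneOn_of_hasDerivWithinAt_nonpos (convex_Icc 0 T)
    (fun t ht ↦ (hd t ht).continuousWithinAt)
    (fun t ht ↦ (hd t (interior_subset ht)).mono interior_subset) (fun t ht ↦ by
      rw [real_inner_comm, inner_truncGradient_left]
      have : ∑ r, k r * (1 / max (inner ℝ (v r) (x t)) δ) * inner ℝ (v r) (x t) ≤ ∑ r, k r := by
        refine Finset.sum_le_sum fun r _ ↦ ?_
        have h : 0 < max (inner ℝ (v r) (x t)) δ := lt_max_of_lt_right hδ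
        rw [mul_assoc, one_div, inv_mul_eq_div]
        exact mul_le_of_le_one_right (hk r) ((div_le_one h).2 (le_max_left _ _))
      linarith)
  have := h (left_mem_Icc.2 (ht.1.trans ht.2)) ht ht.1
  simp only [Pi.sub_apply, id, mul_zero, sub_zero] at this
  linarith

/-- The truncated field is the gradient of this sum, whose derivative along the flow is therefore
the squared norm of the field. -/
theorem monotoneOn_sum_truncLog (hδ : 0 < δ) {T : ℝ} {x : ℝ → E}
    (hx : ∀ t ∈ Icc 0 T, HasDerivWithinAt x (truncGradient v k δ (x t)) (Icc 0 T) t) :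
    MonotoneOn (fun t ↦ ∑ r, k r * truncLog δ (inner ℝ (v r) (x t))) (Icc 0 T) := by
  have hd : ∀ t ∈ Icc 0 T, HasDerivWithinAt
      (fun t ↦ ∑ r, k r * truncLog δ (inner ℝ (v r) (x t)))
      (‖truncGradient v k δ (x t)‖ ^ 2) (Icc 0 T) t := by
    intro t ht
    rw [← real_inner_self_eq_norm_sq, inner_truncGradient_left]
    refine HasDerivWithinAt.fun_sum fun r _ ↦ ?_
    have h := (innerSL ℝ (v r)).hasFDerivAt.comp_hasDerivWithinAt t (hx t ht)
    refine (((hasDerivAt_truncLog hδ _).comp_hasDerivWithinAt t h).const_mul (k r)).congr_deriv ?_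
    simp only [Function.comp_apply, innerSL_apply_apply]
    ring
  exact monotoneOn_of_hasDerivWithinAt_nonneg (convex_Icc 0 T)
    (fun t ht ↦ (hd t ht).continuousWithinAt)
    (fun t ht ↦ (hd t (interior_subset ht)).mono interior_subset) fun t _ ↦ by positivity

/-- A lower bound for the truncated logarithmic potential keeps all `⟪v r, x⟫` above `δ`. -/
theorem lt_of_sum_truncLog_le (hk : ∀ r, 0 < k r) (hδ : 0 < δ) {A : ℝ} (hA : 1 ≤ A)
    (hδA : δ ≤ A) {a b : ι → ℝ} (ha : ∀ r, δ ≤ a r) (hb : ∀ r, b r ≤ A)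
    (hs : ∀ s, k s * Real.log δ < ∑ r, k r * (Real.log (a r) - Real.log A))
    (hab : ∑ r, k r * truncLog δ (a r) ≤ ∑ r, k r * truncLog δ (b r)) (s : ι) : δ < b s := by
  classical
  by_contra! hbs
  set c := Real.log A - Real.log δ
  -- If b s ≤ δ, the term at s is at most 0 and every other term is at most k r * c. This loss of k
  -- s * c contradicts `hs`, as log A ≥ 0.
  have h1 : ∑ r, k r * truncLog δ (b r) ≤ ∑ r, (k r * c - if r = s then k s * c else 0) := by
    refine Finset.sum_le_sum fun r _ ↦ ?_
    split_ifs with h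
    · subst h
      rw [sub_self]
      exact mul_nonpos_of_nonneg_of_nonpos (hk r).le (truncLog_nonpos hδ hbs)
    · rw [sub_zero, show c = truncLog δ A from (truncLog_of_le hδ hδA).symm]
      exact mul_le_mul_of_nonneg_left (monotone_truncLog hδ (hb r)) (hk r).le
  rw [Finset.sum_sub_distrib, Finset.sum_ite_eq' Finset.univ s, if_pos (Finset.mem_univ s)] at h1
  have h2 : ∑ r, k r * (Real.log (a r) - Real.log A) =
      ∑ r, k r * truncLog δ (a r) - ∑ r, k r * c := by
    rw [← Finset.sum_sub_distrib]
    refine Finset.sum_congr rfl fun r _ ↦ ?_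
    rw [truncLog_of_le hδ (ha r)]
    ring
  have h3 := hs s
  have h4 : 0 ≤ k s * Real.log A := mul_nonneg (hk s).le (Real.log_nonneg hA)
  have h5 : k s * c = k s * Real.log A - k s * Real.log δ := mul_sub _ _ _
  linarith

theorem exists_logGradient_flow_Icc [CompleteSpace E] (hk : ∀ r, 0 < k r) {x₀ : E}
    (hx₀ : x₀ ∈ openCone v) {T : ℝ} (hT : 0 ≤ T) :
    ∃ x : ℝ → E, x 0 = x₀ ∧ (∀ t ∈ Icc 0 T, x t ∈ openCone v) ∧
      ∀ t ∈ Icc 0 T, HasDerivWithinAt x (logGradient v k (x t)) (Icc 0 T) t := by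
  have hk' := fun r ↦ (hk r).le
  have hK : 0 ≤ ∑ r, k r := Finset.sum_nonneg fun r _ ↦ hk' r
  set R : ℝ := √(‖x₀‖ ^ 2 + 2 * (∑ r, k r) * T)
  set A : ℝ := 1 + ∑ r, ‖v r‖ * R
  have hA : 1 ≤ A := le_add_of_nonneg_right (by positivity)
  obtain ⟨δ, h1, h2, h3, hδ⟩ : ∃ δ : ℝ, (∀ s, δ < inner ℝ (v s) x₀) ∧
      (∀ s, k s * Real.log δ < ∑ r, k r * (Real.log (inner ℝ (v r) x₀) - Real.log A)) ∧
      δ < A ∧ 0 < δ := by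
    -- A does not depend on δ, while log δ → -∞ as δ → 0+, so all conditions hold for small δ.
    refine Eventually.exists (f := 𝓝[>] (0 : ℝ)) ?_
    refine (eventually_all.2 fun s ↦ ?_).and ((eventually_all.2 fun s ↦ ?_).and
      (Eventually.and ?_ self_mem_nhdsWithin))
    · exact mem_nhdsWithin_of_mem_nhds (Iio_mem_nhds (hx₀ s))
    · exact (Real.tendsto_log_nhdsGT_zero.const_mul_atBot (hk s)).eventually_lt_atBot _
    · exact mem_nhdsWithin_of_mem_nhds (Iio_mem_nhds (by linarith))
  obtain ⟨x, hx0, hx⟩ := exists_truncGradient_flow (v := v) hk' hδ x₀ hT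
  have key : ∀ t ∈ Icc 0 T, ∀ r, δ < inner ℝ (v r) (x t) := by
    intro t ht
    refine lt_of_sum_truncLog_le hk hδ hA h3.le (fun r ↦ (h1 r).le) (fun r ↦ ?_) h2 ?_
    · have hR : ‖x t‖ ≤ R := by
        refine Real.le_sqrt_of_sq_le ((norm_sq_le_of_truncGradient hk' hδ hx ht).trans ?_)
        rw [hx0]
        gcongr
        exact ht.2
      calc inner ℝ (v r) (x t) ≤ ‖v r‖ * ‖x t‖ := real_inner_le_norm _ _
        _ ≤ ‖v r‖ * R := by gcongr
        _ ≤ ∑ r, ‖v r‖ * R :=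
          Finset.single_le_sum (f := fun r ↦ ‖v r‖ * R) (fun r _ ↦ by positivity)
            (Finset.mem_univ r)
        _ ≤ A := by simp [A]
    · have := monotoneOn_sum_truncLog hδ hx (left_mem_Icc.2 hT) ht ht.1
      simpa only [hx0] using this
  refine ⟨x, hx0, fun t ht r ↦ hδ.trans (key t ht r), fun t ht ↦ ?_⟩
  rw [← truncGradient_eq_logGradient fun r ↦ (key t ht r).le]
  exact hx t ht

/-- The gradient flow started in the cone exists for all times and stays in the cone. -/
theorem exists_logGradient_flow [CompleteSpace E] (hk : ∀ r, 0 < k r) {x₀ : E}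
    (hx₀ : x₀ ∈ openCone v) :
    ∃ x : ℝ → E, x 0 = x₀ ∧ (∀ t ∈ Ici (0 : ℝ), x t ∈ openCone v) ∧
      ∀ t ∈ Ici (0 : ℝ), HasDerivWithinAt x (logGradient v k (x t)) (Ici 0) t := by
  choose X hX0 hXm hX using fun n : ℕ ↦
    exists_logGradient_flow_Icc hk hx₀ (T := (n : ℝ)) n.cast_nonneg
  have heq : ∀ m n : ℕ, m ≤ n → EqOn (X m) (X n) (Icc 0 m) := by
    intro m n hmn
    have hsub : Icc (0 : ℝ) m ⊆ Icc 0 n := Icc_subset_Icc_right (Nat.cast_le.2 hmn)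
    exact eqOn_of_logGradient (fun r ↦ (hk r).le) (convex_Icc 0 _)
      ⟨left_mem_Icc.2 m.cast_nonneg, fun t ht ↦ ht.1⟩ (hXm m)
      (fun t ht ↦ hXm n t (hsub ht)) (hX m) (fun t ht ↦ (hX n t (hsub ht)).mono hsub)
      ((hX0 m).trans (hX0 n).symm)
  have heq' : ∀ (n : ℕ) (t : ℝ), t ∈ Icc (0 : ℝ) n → X ⌈t⌉₊ t = X n t := fun n t ht ↦
    heq _ n (Nat.ceil_le.2 ht.2) ⟨ht.1, Nat.le_ceil t⟩
  refine ⟨fun t ↦ X ⌈t⌉₊ t, by simp [hX0], fun t ht ↦ hXm _ t ⟨ht, Nat.le_ceil t⟩,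
    fun t ht ↦ ?_⟩
  -- Strict inequality makes [0, n] a neighbourhood of t within [0, ∞).
  obtain ⟨n, hn⟩ := exists_nat_gt t
  have htn : t ∈ Icc (0 : ℝ) n := ⟨ht, hn.le⟩
  have h1 : HasDerivWithinAt (fun t ↦ X ⌈t⌉₊ t) (logGradient v k (X ⌈t⌉₊ t)) (Icc 0 n) t := by
    rw [heq' n t htn]
    exact (hX n t htn).congr (fun s hs ↦ heq' n s hs) (heq' n t htn)
  refine h1.mono_of_mem_nhdsWithin ?_
  rw [← Ici_inter_Iic]
  exact inter_mem self_mem_nhdsWithin (mem_nhdsWithin_of_mem_nhds (Iic_mem_nhds hn))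

end TruncatedFlow

/-! ### Critical points and self-similar asymptotics -/

section SelfSimilar

open Set

variable {E ι : Type*} [NormedAddCommGroup E] [InnerProductSpace ℝ E] {v : ι → E}

theorem ne_zero_of_mem_openCone [Nonempty ι] {x : E} (hx : x ∈ openCone v) : x ≠ 0 := by
  rintro rfl
  simpa using hx (Classical.arbitrary ι)

theorem smul_mem_openCone {c : ℝ} (hc : 0 < c) {x : E} (hx : x ∈ openCone v) :
    c • x ∈ openCone v := fun r ↦ by
  rw [real_inner_smul_right]
  exact mul_pos hc (hx r)

variable [Fintype ι] {k : ι → ℝ}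

theorem isOpen_openCone : IsOpen (openCone v) := by
  simp only [openCone, ofPred_forall]
  exact isOpen_iInter_of_finite fun r ↦ isOpen_lt continuous_const (by fun_prop)

/-- The logarithmic potential, made homogeneous of degree zero. -/
noncomputable def homogLogPotential (v : ι → E) (k : ι → ℝ) (x : E) : ℝ :=
  ∑ r, k r * Real.log (inner ℝ (v r) x) - (∑ r, k r) / 2 * Real.log (‖x‖ ^ 2)

/-- For positive weights the product, as a function of a unit vector, is continuous everywhere and
vanishes off the open cone. A maximiser on the compact sphere thus lies automatically in the cone.
-/
theorem homogLogPotential_eq_log_prod [Nonempty ι] {x : E} (hx : x ∈ openCone v) :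
    homogLogPotential v k x = Real.log (∏ r, max (inner ℝ (v r) (‖x‖⁻¹ • x)) 0 ^ k r) := by
  have hx0 : 0 < ‖x‖ := norm_pos_iff.2 (ne_zero_of_mem_openCone hx)
  have hpos := smul_mem_openCone (inv_pos.2 hx0) hx
  rw [Real.log_prod fun r _ ↦
    (Real.rpow_pos_of_pos (lt_max_of_lt_left (hpos r)) _).ne', homogLogPotential, Finset.sum_div,
    Finset.sum_mul, ← Finset.sum_sub_distrib]
  refine Finset.sum_congr rfl fun r _ ↦ ?_
  rw [Real.log_rpow (lt_max_of_lt_left (hpos r)), max_eq_left (hpos r).le, real_inner_smul_right,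
    Real.log_mul (inv_pos.2 hx0).ne' (hx r).ne', Real.log_inv, Real.log_pow]
  push_cast
  ring

theorem exists_isMaxOn_homogLogPotential [FiniteDimensional ℝ E] [Nonempty ι]
    (hk : ∀ r, 0 < k r) (hne : (openCone v).Nonempty) :
    ∃ z ∈ openCone v, ‖z‖ = 1 ∧ IsMaxOn (homogLogPotential v k) (openCone v) z := by
  have := FiniteDimensional.proper ℝ E
  obtain ⟨x₀, hx₀⟩ := hne
  have hmem : ∀ x ∈ openCone v, ‖x‖⁻¹ • x ∈ Metric.sphere (0 : E) 1 := fun x hx ↦ by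
    rw [mem_sphere_zero_iff_norm]
    exact norm_smul_inv_norm (𝕜 := ℝ) (ne_zero_of_mem_openCone hx)
  set G : E → ℝ := fun x ↦ ∏ r, max (inner ℝ (v r) x) 0 ^ k r
  have hGpos : ∀ x ∈ openCone v, 0 < G x := fun x hx ↦
    Finset.prod_pos fun r _ ↦ Real.rpow_pos_of_pos (lt_max_of_lt_left (hx r)) _
  have hGc : Continuous G := by
    refine continuous_finsetProd _ fun r _ ↦ Continuous.rpow_const (by fun_prop) fun x ↦ ?_
    exact Or.inr (hk r).le
  have hn : ∀ x ∈ openCone v, ‖x‖⁻¹ • x ∈ openCone v := fun x hx ↦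
    smul_mem_openCone (inv_pos.2 (norm_pos_iff.2 (ne_zero_of_mem_openCone hx))) hx
  obtain ⟨z, hz, hmax⟩ := (isCompact_sphere (0 : E) 1).exists_isMaxOn ⟨_, hmem x₀ hx₀⟩
    hGc.continuousOn
  have hzpos : 0 < G z := (hGpos _ (hn x₀ hx₀)).trans_le (hmax (hmem x₀ hx₀))
  have hz1 : ‖z‖ = 1 := mem_sphere_zero_iff_norm.1 hz
  have hzm : z ∈ openCone v := by
    intro r
    by_contra! h
    refine hzpos.ne' (Finset.prod_eq_zero (Finset.mem_univ r) ?_)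
    rw [max_eq_right h, Real.zero_rpow (hk r).ne']
  refine ⟨z, hzm, hz1, fun x hx ↦ ?_⟩
  rw [mem_ofPred_eq, homogLogPotential_eq_log_prod hx, homogLogPotential_eq_log_prod hzm]
  refine Real.log_le_log (hGpos _ (hn x hx)) ?_
  rw [hz1, inv_one, one_smul]
  exact hmax (hmem x hx)

/-- Homogeneity makes the maximum unconstrained, so no Lagrange multiplier is needed: the term (K/2)
log ‖x‖² has gradient K z at a unit vector z. -/
theorem logGradient_eq_smul_of_isMaxOn {z : E} (hz : z ∈ openCone v) (hz1 : ‖z‖ = 1)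
    (hmax : IsMaxOn (homogLogPotential v k) (openCone v) z) :
    logGradient v k z = (∑ r, k r) • z := by
  refine ext_inner_right ℝ fun h ↦ ?_
  have hloc : IsLocalMax (fun s : ℝ ↦ homogLogPotential v k (z + s • h)) 0 := by
    have hc : ContinuousAt (fun s : ℝ ↦ z + s • h) 0 := by fun_prop
    have := hmax.isLocalMax (isOpen_openCone.mem_nhds hz)
    have h' : IsLocalMax (homogLogPotential v k) ((fun s : ℝ ↦ z + s • h) 0) := by simpa using this
    exact IsMaxFilter.comp_tendsto (g := fun s : ℝ ↦ z + s • h) h' hc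
  have hl : HasDerivAt (fun s : ℝ ↦ z + s • h) h 0 := by
    simpa using ((hasDerivAt_id (0 : ℝ)).smul_const h).const_add z
  have hd : HasDerivAt (fun s : ℝ ↦ homogLogPotential v k (z + s • h))
      (∑ r, k r * (inner ℝ (v r) h / inner ℝ (v r) z) - (∑ r, k r) / 2 * (2 * inner ℝ z h)) 0 := by
    refine (HasDerivAt.fun_sum fun r _ ↦ ?_).sub ?_
    · have h1 := (innerSL ℝ (v r)).hasFDerivAt.comp_hasDerivAt 0 hl
      have h2 := (h1.log (by simpa using (hz r).ne')).const_mul (k r)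
      simpa using h2
    · have h1 := (hl.norm_sq.log (by simp [hz1])).const_mul ((∑ r, k r) / 2)
      simpa [hz1] using h1
  have := hloc.hasDerivAt_eq_zero hd
  rw [inner_logGradient_left, real_inner_smul_left]
  simp only [div_mul_eq_mul_div, mul_div_assoc'] at this ⊢
  linarith

/-- The logarithmic potential minus `‖x‖ ^ 2 / 2` has a critical point in the cone. -/
theorem exists_logGradient_eq_self [FiniteDimensional ℝ E] [Nonempty ι]
    (hk : ∀ r, 0 < k r) (hne : (openCone v).Nonempty) :
    ∃ y ∈ openCone v, logGradient v k y = y := by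
  obtain ⟨z, hz, hz1, hmax⟩ := exists_isMaxOn_homogLogPotential hk hne
  have hK : 0 < ∑ r, k r := Finset.sum_pos (fun r _ ↦ hk r) Finset.univ_nonempty
  have hs := Real.sqrt_pos.2 hK
  -- The field has degree -1, so c • z is fixed when c² = K.
  refine ⟨√(∑ r, k r) • z, smul_mem_openCone hs hz, ?_⟩
  rw [logGradient_smul, logGradient_eq_smul_of_isMaxOn hz hz1 hmax, smul_smul]
  congr 1
  rw [inv_mul_eq_div, Real.div_sqrt]

/-- Every solution, rescaled to the unit sphere, converges to the direction of a critical point. -/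
theorem tendsto_inv_sqrt_smul_of_logGradient (hk : ∀ r, 0 ≤ k r) (hK : 0 < ∑ r, k r)
    {y : E} (hy : y ∈ openCone v) (hyF : logGradient v k y = y) {x : ℝ → E}
    (hx0 : x 0 ≠ 0) (hxm : ∀ t ∈ Ici (0 : ℝ), x t ∈ openCone v)
    (hx : ∀ t ∈ Ici (0 : ℝ), HasDerivWithinAt x (logGradient v k (x t)) (Ici 0) t) :
    Tendsto (fun t ↦ (√(2 * (∑ r, k r) * t + ‖x 0‖ ^ 2))⁻¹ • x t) atTop
      (𝓝 ((√(∑ r, k r))⁻¹ • y)) := by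
  set K := ∑ r, k r
  set ρ : ℝ → ℝ := fun t ↦ √(2 * K * t + ‖x 0‖ ^ 2) with hρ
  have hK' := Real.sqrt_pos.2 hK
  have hx0' := norm_pos_iff.2 hx0
  have hpos : ∀ t ∈ Ici (0 : ℝ), 0 < 2 * K * t + ‖x 0‖ ^ 2 := fun t ht ↦ by
    have : (0 : ℝ) ≤ t := ht
    positivity
  have hρpos : ∀ t ∈ Ici (0 : ℝ), 0 < ρ t := fun t ht ↦ Real.sqrt_pos.2 (hpos t ht)
  have hρ' : ∀ t ∈ Ici (0 : ℝ), HasDerivWithinAt ρ (K / ρ t) (Ici 0) t := by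
    intro t ht
    have h1 : HasDerivAt (fun t ↦ 2 * K * t + ‖x 0‖ ^ 2) (2 * K) t := by
      simpa using ((hasDerivAt_id t).const_mul (2 * K)).add_const (‖x 0‖ ^ 2)
    refine ((h1.sqrt (hpos t ht).ne').congr_deriv ?_).hasDerivWithinAt
    rw [mul_div_mul_left _ _ two_ne_zero]
  -- The self-similar solution: ρ ρ' = K and the degree -1 of the field make it solve the equation.
  set w : ℝ → E := fun t ↦ (ρ t * (√K)⁻¹) • y
  have hw : ∀ t ∈ Ici (0 : ℝ), HasDerivWithinAt w (logGradient v k (w t)) (Ici 0) t := by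
    intro t ht
    refine (((hρ' t ht).mul_const (√K)⁻¹).smul_const y).congr_deriv ?_
    rw [logGradient_smul, hyF]
    congr 1
    have := (hρpos t ht).ne'
    field_simp
    exact (Real.sq_sqrt hK.le).symm
  have hanti := antitoneOn_norm_sub_of_logGradient hk (convex_Ici 0) hxm
    (fun t ht ↦ smul_mem_openCone (mul_pos (hρpos t ht) (inv_pos.2 hK')) hy) hx hw
  have hρtop : Tendsto ρ atTop atTop := by
    refine Real.tendsto_sqrt_atTop.comp (tendsto_atTop_add_const_right _ _ ?_)
    exact tendsto_id.const_mul_atTop (by positivity)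
  rw [tendsto_iff_norm_sub_tendsto_zero]
  refine squeeze_zero' (g := fun t ↦ ‖x 0 - w 0‖ * (ρ t)⁻¹)
    (Eventually.of_forall fun _ ↦ norm_nonneg _) ?_ ?_
  · filter_upwards [eventually_ge_atTop 0] with t ht
    have hp := hρpos t ht
    have h1 : (ρ t)⁻¹ • x t - (√K)⁻¹ • y = (ρ t)⁻¹ • (x t - w t) := by
      simp only [w]
      rw [smul_sub, smul_smul, inv_mul_cancel_left₀ hp.ne']
    rw [show √(2 * K * t + ‖x 0‖ ^ 2) = ρ t from rfl, h1, norm_smul, norm_inv,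
      Real.norm_of_nonneg hp.le, mul_comm]
    exact mul_le_mul_of_nonneg_right (hanti self_mem_Ici ht ht) (inv_pos.2 hp).le
  · simpa using hρtop.inv_tendsto_atTop.const_mul ‖x 0 - w 0‖

end SelfSimilar

/-! ### The root system B_N -/

section TypeB

variable {N : ℕ}

/-- The positive roots of type `B_N`, indexed by pairs: `e_i - e_j` for `i < j`, `e_i + e_j` for
`j < i` and `e_i` for `i = j`. -/
noncomputable def rootB (p : Fin N × Fin N) : EuclideanSpace ℝ (Fin N) :=
  if p.1 < p.2 then EuclideanSpace.single p.1 1 - EuclideanSpace.single p.2 1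
  else if p.2 < p.1 then EuclideanSpace.single p.1 1 + EuclideanSpace.single p.2 1
  else EuclideanSpace.single p.1 1

/-- The multiplicity `ν` on the short roots, `1` on the long ones. -/
noncomputable def weightB (ν : ℝ) (p : Fin N × Fin N) : ℝ := if p.1 = p.2 then ν else 1

theorem inner_rootB (p : Fin N × Fin N) (x : EuclideanSpace ℝ (Fin N)) :
    inner ℝ (rootB p) x =
      if p.1 < p.2 then x p.1 - x p.2 else if p.2 < p.1 then x p.1 + x p.2 else x p.1 := by
  unfold rootB
  split_ifs <;> simp [inner_sub_left, inner_add_left, EuclideanSpace.inner_single_left]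

theorem weightB_pos {ν : ℝ} (hν : 0 < ν) (p : Fin N × Fin N) : 0 < weightB ν p := by
  unfold weightB
  split_ifs <;> positivity

theorem sum_weightB (N : ℕ) (ν : ℝ) :
    ∑ p : Fin N × Fin N, weightB ν p = (N : ℝ) * ((N : ℝ) + ν - 1) := by
  have h : ∀ p : Fin N × Fin N, weightB ν p = 1 + if p.1 = p.2 then ν - 1 else 0 := by
    intro p
    unfold weightB
    split_ifs <;> ring
  simp only [h, Fintype.sum_prod_type, Finset.sum_add_distrib, Finset.sum_ite_eq, Finset.mem_univ,
    if_true, Finset.sum_const, Finset.card_univ, Fintype.card_prod, Fintype.card_fin, nsmul_eq_mul]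
  push_cast
  ring

theorem openCone_rootB : openCone (rootB (N := N)) = weylChamberB N := by
  ext x
  constructor
  · intro h
    refine ⟨fun i j hij ↦ ?_, fun i ↦ ?_⟩
    · have := h (i, j)
      rw [inner_rootB, if_pos hij] at this
      exact sub_pos.1 this
    · simpa [inner_rootB] using h (i, i)
  · rintro ⟨h1, h2⟩ p
    rw [inner_rootB]
    split_ifs with h h'
    · exact sub_pos.2 (h1 _ _ h)
    · exact add_pos (h2 _) (h2 _)
    · exact h2 _

theorem logGradient_rootB (ν : ℝ) (x : EuclideanSpace ℝ (Fin N)) :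
    logGradient rootB (weightB ν) x = fieldB N ν x := by
  ext l
  -- The pair (a, b) contributes `α a b` to coordinate a and `β a b` to coordinate b. For j ≠ l, one
  -- of (l, j), (j, l) carries the difference root and the other the sum root; together they give
  -- the j-th summand of the field.
  set α : Fin N → Fin N → ℝ := fun a b ↦
    if a < b then 1 / (x a - x b) else if b < a then 1 / (x a + x b) else ν / x a
  set β : Fin N → Fin N → ℝ := fun a b ↦
    if a < b then -(1 / (x a - x b)) else if b < a then 1 / (x a + x b) else 0
  have hT : ∀ p : Fin N × Fin N, weightB ν p / inner ℝ (rootB p) x * rootB p l =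
      (if l = p.1 then α p.1 p.2 else 0) + if l = p.2 then β p.1 p.2 else 0 := by
    rintro ⟨a, b⟩
    rw [inner_rootB]
    rcases lt_trichotomy a b with h | h | h
    · simp only [weightB, rootB, α, β, if_pos h, if_neg h.ne, PiLp.sub_apply,
        PiLp.single_apply]
      split_ifs <;> ring
    · subst h
      simp [weightB, rootB, α, β]
    · simp only [weightB, rootB, α, β, if_pos h, if_neg h.ne', if_neg h.not_gt, PiLp.add_apply,
        PiLp.single_apply]
      split_ifs <;> ring
  have hL : logGradient rootB (weightB ν) x l = ∑ b, (α l b + β b l) := by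
    simp only [logGradient, WithLp.ofLp_sum, Finset.sum_apply, PiLp.smul_apply, smul_eq_mul, hT]
    rw [Finset.sum_add_distrib, Fintype.sum_prod_type, Fintype.sum_prod_type_right,
      Finset.sum_add_distrib]
    congr 1 <;> rw [Finset.sum_comm] <;> simp
  rw [hL, ← Finset.sum_erase_add _ _ (Finset.mem_univ l)]
  show _ = (∑ j ∈ Finset.univ.erase l, (1 / (x l - x j) + 1 / (x l + x j))) + ν / x l
  congr 1
  · refine Finset.sum_congr rfl fun j hj ↦ ?_
    rcases (Finset.ne_of_mem_erase hj).lt_or_gt with h | h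
    · simp only [α, β, if_pos h, if_neg h.not_gt]
      rw [← div_neg, neg_sub, add_comm]
    · simp only [α, β, if_pos h, if_neg h.not_gt, add_comm (x l)]
  · simp [α, β]

theorem nonempty_weylChamberB (N : ℕ) : (weylChamberB N).Nonempty := by
  refine ⟨WithLp.toLp 2 fun i ↦ (N : ℝ) - (i : ℕ), fun i j hij ↦ ?_, fun i ↦ ?_⟩
  · have : ((i : ℕ) : ℝ) < ((j : ℕ) : ℝ) := Nat.cast_lt.2 hij
    show (N : ℝ) - (j : ℕ) < (N : ℝ) - (i : ℕ)
    linarith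
  · have : ((i : ℕ) : ℝ) < N := Nat.cast_lt.2 i.2
    show 0 < (N : ℝ) - (i : ℕ)
    linarith

theorem exists_fieldB_eq_self (hN : 1 ≤ N) {ν : ℝ} (hν : 0 < ν) :
    ∃ y ∈ weylChamberB N, fieldB N ν y = y := by
  have : Nonempty (Fin N) := ⟨⟨0, hN⟩⟩
  obtain ⟨y, hy, h⟩ := exists_logGradient_eq_self (v := rootB (N := N)) (weightB_pos hν)
    (openCone_rootB ▸ nonempty_weylChamberB N)
  exact ⟨y, openCone_rootB ▸ hy, logGradient_rootB ν y ▸ h⟩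

end TypeB

/-! ### Stieltjes' characterisation of the Laguerre zeros -/

section Laguerre

open Polynomial

theorem eval_derivative_nodal_erase {ι F : Type*} [Field F] [DecidableEq ι] (s : Finset ι)
    (u : ι → F) (i : ι) (h : ∀ j ∈ s.erase i, u i ≠ u j) :
    (derivative (Lagrange.nodal (s.erase i) u)).eval (u i) =
      (Lagrange.nodal (s.erase i) u).eval (u i) * ∑ j ∈ s.erase i, 1 / (u i - u j) := by
  rw [Lagrange.derivative_nodal, eval_finsetSum, Finset.mul_sum]
  refine Finset.sum_congr rfl fun j hj ↦ ?_
  rw [Lagrange.nodal_eq_mul_nodal_erase hj, eval_mul, eval_sub, eval_X, eval_C, mul_one_div,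
    mul_div_cancel_left₀ _ (sub_ne_zero.2 (h j hj))]

/-- Writing P = (X - u_i) Q gives P'(u_i) = Q(u_i) and P''(u_i) = 2 Q'(u_i). -/
theorem eval_derivative_nodal_self {ι F : Type*} [Field F] [DecidableEq ι] {s : Finset ι}
    (u : ι → F) {i : ι} (hi : i ∈ s) (h : ∀ j ∈ s.erase i, u i ≠ u j) :
    (derivative (derivative (Lagrange.nodal s u))).eval (u i) =
      2 * (derivative (Lagrange.nodal s u)).eval (u i) * ∑ j ∈ s.erase i, 1 / (u i - u j) := by
  rw [Lagrange.nodal_eq_mul_nodal_erase hi]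
  simp only [derivative_mul, derivative_sub, derivative_X, derivative_C, sub_zero, one_mul,
    derivative_add, eval_add, eval_mul, eval_sub, eval_X, eval_C, sub_self, zero_mul, add_zero,
    eval_derivative_nodal_erase s u i h]
  ring

theorem coeff_laguerre_operator (P : ℝ[X]) (ν : ℝ) (N n : ℕ) :
    (X * derivative (derivative P) + (C ν - X) * derivative P + C (N : ℝ) * P).coeff n =
      ((n : ℝ) + 1) * ((n : ℝ) + ν) * P.coeff (n + 1) + ((N : ℝ) - n) * P.coeff n := by
  rw [sub_mul]
  cases n with
  | zero => simp [coeff_derivative]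
  | succ n =>
    simp only [coeff_add, coeff_sub, coeff_X_mul, coeff_C_mul, coeff_derivative]
    push_cast
    ring

/-- A configuration with `2 u i ∑ 1 / (u i - u j) + ν = u i` yields Laguerre's equation. -/
theorem laguerre_equation_nodal {N : ℕ} {ν : ℝ} {u : Fin N → ℝ} (hu : Function.Injective u)
    (h : ∀ i, 2 * u i * ∑ j ∈ Finset.univ.erase i, 1 / (u i - u j) + ν = u i) :
    X * derivative (derivative (Lagrange.nodal Finset.univ u)) +
      (C ν - X) * derivative (Lagrange.nodal Finset.univ u) +
      C (N : ℝ) * Lagrange.nodal Finset.univ u = 0 := by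
  have hdeg : (Lagrange.nodal Finset.univ u).natDegree = N := by simp
  -- The coefficient of X^N cancels, so the left side has degree below N; it vanishes at the N
  -- nodes.
  refine Polynomial.eq_zero_of_degree_lt_of_eval_index_eq_zero (s := Finset.univ) (v := u)
    hu.injOn ?_
    fun i _ ↦ ?_
  · rw [Finset.card_univ, Fintype.card_fin, degree_lt_iff_coeff_zero]
    intro n hn
    rw [coeff_laguerre_operator, coeff_eq_zero_of_natDegree_lt (by omega), mul_zero, zero_add]
    rcases hn.eq_or_lt with rfl | hn
    · rw [sub_self, zero_mul]
    · rw [coeff_eq_zero_of_natDegree_lt (by omega), mul_zero]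
  · simp only [eval_add, eval_mul, eval_sub, eval_X, eval_C,
      Lagrange.eval_nodal_at_node (Finset.mem_univ i), mul_zero, add_zero]
    rw [eval_derivative_nodal_self u (Finset.mem_univ i) fun j hj ↦
      hu.ne (Finset.ne_of_mem_erase hj).symm]
    linear_combination (derivative (Lagrange.nodal Finset.univ u)).eval (u i) * h i

theorem coeff_laguerrePoly {N : ℕ} (α : ℝ) {n : ℕ} (hn : n ≤ N) :
    (laguerrePoly N α).coeff n = (-1) ^ n * ((∏ j ∈ Finset.Icc (n + 1) N, (α + (j : ℝ))) /
      ((N - n).factorial : ℝ)) / (n.factorial : ℝ) := by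
  simp only [laguerrePoly, finsetSum_coeff, coeff_C_mul, coeff_X_pow, mul_ite, mul_one, mul_zero]
  rw [Finset.sum_ite_eq, if_pos (Finset.mem_range.2 (by omega))]

theorem coeff_laguerrePoly_succ {N : ℕ} (ν : ℝ) {n : ℕ} (hn : n < N) :
    ((n : ℝ) + 1) * ((n : ℝ) + ν) * (laguerrePoly N (ν - 1)).coeff (n + 1) +
      ((N : ℝ) - n) * (laguerrePoly N (ν - 1)).coeff n = 0 := by
  obtain ⟨m, rfl⟩ : ∃ m, N = n + 1 + m := ⟨N - (n + 1), by omega⟩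
  rw [coeff_laguerrePoly _ (by omega), coeff_laguerrePoly _ (by omega),
    ← Finset.insert_Icc_add_one_left_eq_Icc (a := n + 1) (b := n + 1 + m) (by omega),
    Finset.prod_insert (by simp), show n + 1 + m - (n + 1) = m by omega,
    show n + 1 + m - n = m + 1 by omega, Nat.factorial_succ, Nat.factorial_succ]
  have h1 : (m.factorial : ℝ) ≠ 0 := Nat.cast_ne_zero.2 m.factorial_ne_zero
  have h2 : (n.factorial : ℝ) ≠ 0 := Nat.cast_ne_zero.2 n.factorial_ne_zero
  have h3 : (m : ℝ) + 1 ≠ 0 := by positivity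
  have h4 : (n : ℝ) + 1 ≠ 0 := by positivity
  push_cast
  field_simp
  ring

theorem coeff_laguerrePoly_self (N : ℕ) (α : ℝ) :
    (-1) ^ N * (N.factorial : ℝ) * (laguerrePoly N α).coeff N = 1 := by
  have h : (N.factorial : ℝ) ≠ 0 := Nat.cast_ne_zero.2 N.factorial_ne_zero
  rw [coeff_laguerrePoly α le_rfl, Finset.Icc_eq_empty (by omega)]
  simp only [Finset.prod_empty, Nat.sub_self, Nat.factorial_zero, Nat.cast_one, div_one, mul_one]
  rw [mul_assoc, mul_div_cancel₀ _ h, ← mul_pow]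
  norm_num

theorem natDegree_laguerrePoly_le (N : ℕ) (α : ℝ) : (laguerrePoly N α).natDegree ≤ N :=
  natDegree_sum_le_of_forall_le _ _ fun k hk ↦
    (natDegree_C_mul_X_pow_le _ k).trans (Nat.lt_succ_iff.1 (Finset.mem_range.1 hk))

/-- Laguerre's equation characterises the monic Laguerre polynomial. -/
theorem eq_laguerrePoly_of_equation {N : ℕ} {ν : ℝ} {P : ℝ[X]} (hP : P.Monic)
    (hdeg : P.natDegree = N)
    (h : X * derivative (derivative P) + (C ν - X) * derivative P + C (N : ℝ) * P = 0) :
    P = C ((-1) ^ N * (N.factorial : ℝ)) * laguerrePoly N (ν - 1) := by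
  ext n
  rw [coeff_C_mul]
  rcases le_or_gt n N with hn | hn
  -- The two-term recurrence is solved downwards from the leading coefficient, because N - n ≠ 0 for
  -- n < N.
  · induction hn using Nat.decreasingInduction with
    | self => rw [coeff_laguerrePoly_self, ← hdeg, hP.coeff_natDegree]
    | of_succ n hn ih =>
      have h1 := coeff_laguerre_operator P ν N n
      rw [h, coeff_zero, ih] at h1
      have h2 := coeff_laguerrePoly_succ ν hn
      have h3 : (N : ℝ) - n ≠ 0 := sub_ne_zero.2 (Nat.cast_lt.2 hn).ne'
      refine mul_left_cancel₀ h3 ?_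
      linear_combination -h1 - (-1) ^ N * (N.factorial : ℝ) * h2
  · rw [coeff_eq_zero_of_natDegree_lt (hdeg.trans_lt hn),
      coeff_eq_zero_of_natDegree_lt ((natDegree_laguerrePoly_le N _).trans_lt hn), mul_zero]

theorem strictAnti_sq_of_mem_weylChamberB {N : ℕ} {y : EuclideanSpace ℝ (Fin N)}
    (hy : y ∈ weylChamberB N) : StrictAnti fun i ↦ y i ^ 2 := fun i j hij ↦
  pow_lt_pow_left₀ (hy.1 i j hij) (hy.2 j).le two_ne_zero

/-- The identity 1/(a - b) + 1/(a + b) = 2a/(a² - b²) turns the fixed-point equation, multiplied by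
y_i, into the Stieltjes relation for u_i = y_i². -/
theorem isRoot_laguerrePoly_iff {N : ℕ} {ν : ℝ} {y : EuclideanSpace ℝ (Fin N)}
    (hy : y ∈ weylChamberB N) (hyF : fieldB N ν y = y) (r : ℝ) :
    (laguerrePoly N (ν - 1)).IsRoot r ↔ ∃ i, y i ^ 2 = r := by
  have hinj := (strictAnti_sq_of_mem_weylChamberB hy).injective
  have hP := eq_laguerrePoly_of_equation (Lagrange.nodal_monic (s := Finset.univ)) (by simp)
    (laguerre_equation_nodal (ν := ν) hinj fun i ↦ ?_)
  · have h0 : (-1) ^ N * (N.factorial : ℝ) ≠ 0 := left_ne_zero_of_mul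
      (a := (-1) ^ N * (N.factorial : ℝ)) (b := (laguerrePoly N (ν - 1)).coeff N)
      (by rw [coeff_laguerrePoly_self]; exact one_ne_zero)
    have h1 := congrArg (eval r) hP
    rw [eval_mul, eval_C, Lagrange.eval_nodal] at h1
    rw [IsRoot.def, ← mul_eq_zero_iff_left h0, ← h1, Finset.prod_eq_zero_iff]
    simp only [Finset.mem_univ, true_and, sub_eq_zero, eq_comm (a := r)]
  · have hi : (∑ j ∈ Finset.univ.erase i, (1 / (y i - y j) + 1 / (y i + y j))) + ν / y i = y i :=
      congrArg (fun z : EuclideanSpace ℝ (Fin N) ↦ z i) hyF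
    have hyi := (hy.2 i).ne'
    have h2 : 2 * y i ^ 2 * ∑ j ∈ Finset.univ.erase i, 1 / (y i ^ 2 - y j ^ 2) =
        y i * ∑ j ∈ Finset.univ.erase i, (1 / (y i - y j) + 1 / (y i + y j)) := by
      rw [Finset.mul_sum, Finset.mul_sum]
      refine Finset.sum_congr rfl fun j hj ↦ ?_
      have h3 : y i + y j ≠ 0 := (add_pos (hy.2 i) (hy.2 j)).ne'
      have h4 : y i ^ 2 - y j ^ 2 ≠ 0 := sub_ne_zero.2 (hinj.ne (Finset.ne_of_mem_erase hj).symm)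
      have h5 : y i - y j ≠ 0 := fun h5 ↦ h4 (by rw [sq_sub_sq, h5, mul_zero])
      rw [sq_sub_sq]
      field_simp
      ring
    rw [h2, eq_sub_of_add_eq hi]
    field_simp
    ring

end Laguerre

/-! ### Assembly -/

theorem mainTheorem8 (N : ℕ) (hN : 1 ≤ N) (ν : ℝ) (hν : 0 < ν) :
    ∃ (z : Fin N → ℝ) (y : EuclideanSpace ℝ (Fin N)),
      -- `z` lists the zeros of `L_N^{(ν-1)}`, which are simple and positive, in decreasing order
      (StrictAnti z ∧ (∀ i, 0 < z i) ∧
        ∀ r : ℝ, (laguerrePoly N (ν - 1)).IsRoot r ↔ ∃ i, z i = r) ∧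
      (y ∈ weylChamberB N ∧ ∀ i, y i ^ 2 = 2 * z i) ∧
      ∀ x₀ ∈ weylChamberB N,
        (∃ x, IsSolutionB N ν x₀ x) ∧
        (∀ x x', IsSolutionB N ν x₀ x → IsSolutionB N ν x₀ x' → Set.EqOn x x' (Set.Ici 0)) ∧
        ∀ x, IsSolutionB N ν x₀ x →
          ∃ φ : ℝ → EuclideanSpace ℝ (Fin N),
            (∀ t : ℝ, 0 ≤ t →
              x t = Real.sqrt (2 * (N : ℝ) * ((N : ℝ) + ν - 1) * t + ‖x₀‖ ^ 2) • φ t ∧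
              ‖φ t‖ = 1) ∧
            Tendsto φ atTop
              (𝓝 ((1 / Real.sqrt (2 * (N : ℝ) * ((N : ℝ) + ν - 1))) • y)) := by
  have : Nonempty (Fin N) := ⟨⟨0, hN⟩⟩
  have hw := weightB_pos (N := N) hν
  have hK := sum_weightB N ν
  have hKpos : 0 < ∑ p : Fin N × Fin N, weightB ν p :=
    Finset.sum_pos (fun p _ ↦ hw p) Finset.univ_nonempty
  have hc : 2 * (N : ℝ) * ((N : ℝ) + ν - 1) = 2 * ∑ p : Fin N × Fin N, weightB ν p := by
    rw [hK, mul_assoc]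
  simp only [hc]
  obtain ⟨y, hy, hyF⟩ := exists_fieldB_eq_self hN hν
  -- The fixed point has squares z_i, whereas the stated vector has squares 2 z_i; hence the factor
  -- √2, which cancels against 1 / √(2K) in the limit.
  refine ⟨fun i ↦ y i ^ 2, √2 • y, ⟨strictAnti_sq_of_mem_weylChamberB hy,
    fun i ↦ pow_pos (hy.2 i) 2, isRoot_laguerrePoly_iff hy hyF⟩, ⟨?_, fun i ↦ ?_⟩,
    fun x₀ hx₀ ↦ ?_⟩
  · rw [← openCone_rootB] at hy ⊢
    exact smul_mem_openCone (by positivity) hy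
  · rw [PiLp.smul_apply, smul_eq_mul, mul_pow, Real.sq_sqrt zero_le_two]
  rw [← openCone_rootB] at hy hx₀
  have hsol : ∀ x, IsSolutionB N ν x₀ x ↔ x 0 = x₀ ∧
      (∀ t ∈ Set.Ici (0 : ℝ), x t ∈ openCone rootB) ∧ ∀ t ∈ Set.Ici (0 : ℝ),
        HasDerivWithinAt x (logGradient rootB (weightB ν) (x t)) (Set.Ici 0) t := by
    intro x
    simp only [openCone_rootB, logGradient_rootB]
    exact ⟨fun h ↦ ⟨h.init, h.mem, h.ode⟩, fun h ↦ ⟨h.1, h.2.1, h.2.2⟩⟩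
  simp only [hsol]
  refine ⟨exists_logGradient_flow hw hx₀, ?_, ?_⟩
  · rintro x x' ⟨h0, hm, hd⟩ ⟨h0', hm', hd'⟩
    exact eqOn_of_logGradient (fun p ↦ (hw p).le) (convex_Ici 0) isLeast_Ici hm hm' hd hd'
      (h0.trans h0'.symm)
  · rintro x ⟨rfl, hm, hd⟩
    refine ⟨fun t ↦ (√(2 * (∑ p : Fin N × Fin N, weightB ν p) * t + ‖x 0‖ ^ 2))⁻¹ • x t,
      fun t ht ↦ ?_, ?_⟩
    · beta_reduce
      rw [← norm_sq_eq_of_logGradient hm hd ht, Real.sqrt_sq (norm_nonneg _)]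
      have h0 : x t ≠ 0 := ne_zero_of_mem_openCone (hm t ht)
      exact ⟨(smul_inv_smul₀ (norm_ne_zero_iff.2 h0) _).symm, norm_smul_inv_norm (𝕜 := ℝ) h0⟩
    · have h1 : (1 / √(2 * ∑ p : Fin N × Fin N, weightB ν p)) • √2 • y =
          (√(∑ p : Fin N × Fin N, weightB ν p))⁻¹ • y := by
        rw [smul_smul, Real.sqrt_mul zero_le_two]
        congr 1
        field_simp
      rw [h1]
      exact tendsto_inv_sqrt_smul_of_logGradient (fun p ↦ (hw p).le) hKpos hy
        ((logGradient_rootB ν y).trans hyF) (ne_zero_of_mem_openCone hx₀) hm hd
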